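/- Two-armed Bernoulli bandits. An instance is a pair $\boldsymbol\mu=(\mu_1,\mu_2)\in\Lambda:=\{\boldsymbol\mu\in(0,1)^2:\mu_1\neq\mu_2\}$; pulling arm $k$ yields an independent Bernoulli$(\mu_k)$ reward. For each budget $T\in\mathbb N$, a (possibly randomized) algorithm chooses sequentially, from past observations, which arm to pull in each of $T$ rounds, and then recommends an arm; both the sampling rule and the decision rule may depend on $T$. Let $p_{\boldsymbol\mu,T}$ be the probability under $\boldsymbol\mu$ that the recommended arm is not the best arm, and let $\omega_k(T)$ be the fraction of the $T$ rounds in which arm $k$ is pulled. Let $p^{\mathrm{u}}_{\boldsymbol\mu,T}$ be the error probability of uniform sampling, which pulls the two arms alternately, starting with arm $1$, and recommends the arm with the larger empirical mean (arm $1$ if they are equal). Suppose that an algorithm performs at least as well as uniform sampling on all instances, that is, for every $\boldsymbol\mu\in\Lambda$, $$\liminf_{T\to\infty}\frac1T\log\frac1{p_{\boldsymbol\mu,T}}\ \ge\ \liminf_{T\to\infty}\frac1T\log\frac1{p^{\mathrm{u}}_{\boldsymbol\mu,T}}$$ (with $\log(1/0)=+\infty$). Then the algorithm is (1) consistent: $\lim_{T\to\infty}p_{\boldsymbol\mu,T}=0$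 for every $\boldsymbol\mu\in\Lambda$; and (2) stable: for every $a\in(0,1)$ and every sequence $(\boldsymbol\pi^{(n)})_{n\ge1}$ in $\Lambda$ with $\boldsymbol\pi^{(n)}\to(a,a)$, $$\lim_{n\to\infty}\lim_{T\to\infty}\mathbb E_{\boldsymbol\pi^{(n)}}[\omega_2(T)]=\tfrac12,$$ in the sense that for every $\varepsilon>0$ there is $N$ such that for every $n\ge N$ there is $T_n$ such that $\left|\mathbb E_{\boldsymbol\pi^{(n)}}[\omega_2(T)]-\tfrac12\right|<\varepsilon$ for all $T\ge T_n$. -/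

import Mathlib

open Filter Topology
open scoped ENNReal unitInterval

noncomputable section

namespace TwoArmBandit

/-- The two arms: `0` is arm 1 and `1` is arm 2. -/
abbrev Arm := Fin 2

/-- A pair of Bernoulli means. -/
abbrev Means := Arm → I

/-- The set of instances: means in the open unit interval, and a unique best arm. -/
def instances : Set Means :=
  {μ | (∀ k, (0 : ℝ) < μ k ∧ (μ k : ℝ) < 1) ∧ μ 0 ≠ μ 1}

/-- The Bernoulli reward distribution of mean `p`; the value `true` is reward 1. -/
def reward (p : I) : PMF Bool :=
  PMF.ofFintype (fun b => if b then ENNReal.ofReal p else ENNReal.ofReal (1 - p)) (by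
    rw [Fintype.sum_bool]
    simp only [if_true, Bool.false_eq_true, if_false]
    rw [← ENNReal.ofReal_add p.2.1 (by linarith [p.2.2])]
    simp)

/-- The observations of the first `t` rounds: pulled arm and reward, in chronological order. -/
abbrev History (t : ℕ) := Fin t → Arm × Bool

/-- A (possibly randomized) algorithm for best-arm identification with fixed budget. For every
budget `T` it has a sampling rule, giving the distribution of the next arm from the observations
of the first `t` rounds, and a decision rule, giving the distribution of the recommended arm from
the observations of all `T` rounds. Deterministic rules, and rules that ignore the budget,
are special cases. -/
structure Algorithm where
  sample : (T : ℕ) → {t : ℕ} → History t → PMF Arm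
  decide : (T : ℕ) → History T → PMF Arm

/-- The law, on the instance `μ` with budget `T`, of the observations of the first `t` rounds. -/
def Algorithm.historyLaw (alg : Algorithm) (μ : Means) (T : ℕ) : (t : ℕ) → PMF (History t)
  | 0 => PMF.pure Fin.elim0
  | t + 1 =>
    (alg.historyLaw μ T t).bind fun h =>
      (alg.sample T h).bind fun k =>
        (reward (μ k)).map fun x => Fin.snoc (α := fun _ => Arm × Bool) h (k, x)

/-- The law of the arm recommended after `T` rounds. -/
def Algorithm.decisionLaw (alg : Algorithm) (μ : Means) (T : ℕ) : PMF Arm :=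
  (alg.historyLaw μ T T).bind (alg.decide T)

/-- The probability that the arm recommended after `T` rounds is not the best one. -/
def Algorithm.errorProb (alg : Algorithm) (μ : Means) (T : ℕ) : ℝ≥0∞ :=
  (alg.decisionLaw μ T).toMeasure {k | ∃ j, μ k < μ j}

/-- The number of pulls of arm `k`. -/
def pulls {t : ℕ} (h : History t) (k : Arm) : ℕ :=
  (Finset.univ.filter fun s => (h s).1 = k).card

/-- The total reward collected from arm `k`. -/
def totalReward {t : ℕ} (h : History t) (k : Arm) : ℕ :=
  (Finset.univ.filter fun s => h s = (k, true)).card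

/-- The empirical mean of arm `k` (0 if the arm was not pulled). -/
def empiricalMean {t : ℕ} (h : History t) (k : Arm) : ℝ :=
  totalReward h k / pulls h k

/-- The sampling proportion `ω_k(T)` of arm `k` in `T` rounds. -/
def proportion {T : ℕ} (h : History T) (k : Arm) : ℝ :=
  pulls h k / T

/-- The expected sampling proportion `𝔼_μ[ω_k(T)]`. -/
def Algorithm.expectedProportion (alg : Algorithm) (μ : Means) (T : ℕ) (k : Arm) : ℝ :=
  ∑ h : History T, (alg.historyLaw μ T T h).toReal * proportion h k

/-- Uniform sampling: the arms are pulled in turn, and the arm with the larger empirical mean is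
recommended (arm 1 if the empirical means are equal). -/
def uniformSampling : Algorithm where
  sample _ t _ := PMF.pure (if Even t then 0 else 1)
  decide _ h := PMF.pure (if empiricalMean h 0 < empiricalMean h 1 then 1 else 0)

/-- The exponential rate of decay of the error probability,
`liminf_{T → ∞} (1 / T) log (1 / p_{μ,T})`; it is `⊤` if the error probability is eventually 0. -/
def Algorithm.errorExponent (alg : Algorithm) (μ : Means) : EReal :=
  liminf (fun T : ℕ => -ENNReal.log (alg.errorProb μ T) / (T : EReal)) atTop

/-- The algorithm performs at least as well as uniform sampling on all instances. -/
def Algorithm.PerformsAsWellAsUniform (alg : Algorithm) : Prop :=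
  ∀ μ ∈ instances, uniformSampling.errorExponent μ ≤ alg.errorExponent μ

/-- Consistency: on every instance the error probability tends to 0 as the budget grows. -/
def Algorithm.IsConsistent (alg : Algorithm) : Prop :=
  ∀ μ ∈ instances, Tendsto (fun T => alg.errorProb μ T) atTop (𝓝 0)

/-- Stability: `lim_{n → ∞} lim_{T → ∞} 𝔼_{π⁽ⁿ⁾}[ω_2(T)] = 1/2` for all `a ∈ (0,1)` and all sequences
of instances `π⁽ⁿ⁾` converging to `(a, a)`. The iterated limit means: for every `ε > 0`,
for all large `n`, for all `T` large (depending on `n`), the expectation is within `ε` of `1/2`. -/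
def Algorithm.IsStable (alg : Algorithm) : Prop :=
  ∀ a : I, (0 : ℝ) < a → (a : ℝ) < 1 →
    ∀ π : ℕ → Means, (∀ n, π n ∈ instances) → Tendsto π atTop (𝓝 fun _ => a) →
      ∀ ε : ℝ, 0 < ε → ∀ᶠ n in atTop, ∀ᶠ T in atTop,
        |alg.expectedProportion (π n) T 1 - 1 / 2| < ε

end TwoArmBandit

end

/-!
An exponential decay of the error probability on an instance `μ` forces the algorithm to tell `μ`
from every instance `π` with the other best arm. By a change of measure
(`Algorithm.decisionProb_mul_le`), the exponent on `μ` is at most the divergence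
`(1 - ω) d(π₁, μ₁) + ω d(π₂, μ₂)`, where `ω` is the expected proportion of pulls of the second arm
on `π` and `d` is the Bernoulli divergence. A Chernoff bound for uniform sampling
(`rateBound_le_errorExponent`) shows that an algorithm as good as uniform sampling has exponent at
least `(μ₁ - μ₂)² / (4 (μ₁ (1 - μ₂) + μ₂ (1 - μ₁)))` on `μ`. This is positive, whence consistency.

For stability let `π` be close to `(a, a)` and compare it with `μ = (a - w x, a + (1 - w) x)`, where
`x` is small and its sign is such that `π` and `μ` have different best arms. To second order in `x`
the lower bound for the exponent is `x² / (8 a (1 - a))`, and the divergence, by `bernoulliKL_le`,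
is at most `((1 - ω) w² + ω (1 - w)²) x² / (2 a (1 - a))`. The bracket equals
`w (1 - w) + (ω - w) (1 - 2 w)`, and `w (1 - w) < 1 / 4` if `w ≠ 1 / 2`; so
`(ω - w) (1 - 2 w) > 0`, that is, `ω` lies on the same side of `w` as `1 / 2`
(`eventually_proportion_side`). The choices `w = 1 / 2 ± ε` confine `ω` to the interval of radius
`ε` about `1 / 2`. As the constraint is affine in `ω`, no convergent subsequence of proportions
is needed.
-/

namespace TwoArmBandit

/-! ### The law of the observations -/

/-- The probability of the reward `x` when the mean is `p`, as a real number. -/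
noncomputable def rewardProb (p : I) (x : Bool) : ℝ := (reward p x).toReal

lemma rewardProb_true (p : I) : rewardProb p true = p := by
  simp [rewardProb, reward, p.2.1]

lemma rewardProb_false (p : I) : rewardProb p false = 1 - p := by
  simp [rewardProb, reward, p.2.2]

/-- The probability, as a real number, that the algorithm pulls arm `k` next after having
observed `h`. -/
noncomputable def Algorithm.sampleProb (alg : Algorithm) (T : ℕ) {t : ℕ} (h : History t)
    (k : Arm) : ℝ :=
  (alg.sample T h k).toReal

/-- The probability of the observations `h` in the first `t` rounds, as a real number. -/
noncomputable def Algorithm.historyProb (alg : Algorithm) (μ : Means) (T t : ℕ)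
    (h : History t) : ℝ :=
  (alg.historyLaw μ T t h).toReal

/-- The history `h` followed by one more round, with observation `z`. -/
abbrev History.push {t : ℕ} (h : History t) (z : Arm × Bool) : History (t + 1) :=
  Fin.snoc (α := fun _ => Arm × Bool) h z

lemma sum_toReal_pmf {α : Type*} [Fintype α] (p : PMF α) : ∑ a, (p a).toReal = 1 := by
  rw [← ENNReal.toReal_sum fun a _ => p.apply_ne_top a, ← tsum_fintype (L := .unconditional _),
    p.tsum_coe, ENNReal.toReal_one]

lemma Algorithm.historyProb_nonneg (alg : Algorithm) (μ : Means) (T t : ℕ) (h : History t) :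
    0 ≤ alg.historyProb μ T t h := ENNReal.toReal_nonneg

lemma Algorithm.sum_historyProb (alg : Algorithm) (μ : Means) (T t : ℕ) :
    ∑ h, alg.historyProb μ T t h = 1 := sum_toReal_pmf _

lemma Algorithm.sum_sampleProb (alg : Algorithm) (T : ℕ) {t : ℕ} (h : History t) :
    ∑ k, alg.sampleProb T h k = 1 := sum_toReal_pmf _

lemma Algorithm.historyProb_push (alg : Algorithm) (μ : Means) (T t : ℕ) (h : History t)
    (z : Arm × Bool) :
    alg.historyProb μ T (t + 1) (h.push z) =
      alg.historyProb μ T t h * (alg.sampleProb T h z.1 * rewardProb (μ z.1) z.2) := by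
  obtain ⟨k, x⟩ := z
  have inj : ∀ (h' : History t) (z' : Arm × Bool), h.push (k, x) = h'.push z' ↔
      h = h' ∧ (k, x) = z' := fun h' z' => Fin.snoc_injective2.eq_iff
  simp only [historyProb, sampleProb, rewardProb, ← ENNReal.toReal_mul]
  congr 1
  change ((alg.historyLaw μ T t).bind fun h' => (alg.sample T h').bind fun k' =>
    (reward (μ k')).map fun x' => h'.push (k', x')) (h.push (k, x)) = _
  simp only [PMF.bind_apply, PMF.map_apply, inj, Prod.mk.injEq]
  rw [tsum_eq_single h (fun h' hh => by simp [hh.symm]),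
    tsum_eq_single k (fun k' hk => by simp [hk.symm]),
    tsum_eq_single x (fun x' hx => by simp [hx.symm])]
  simp

lemma sum_history_succ {t : ℕ} (F : History (t + 1) → ℝ) :
    ∑ h, F h = ∑ h : History t, ∑ z : Arm × Bool, F (h.push z) := by
  rw [Finset.sum_comm, ← Fintype.sum_prod_type']
  exact (Fintype.sum_equiv (Fin.snocEquiv fun _ : Fin (t + 1) => Arm × Bool) _ _
    fun _ => rfl).symm

/-- Every history of `t + 1` rounds is a history of `t` rounds followed by one round. -/
lemma History.exists_push {t : ℕ} (h : History (t + 1)) :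
    ∃ (h' : History t) (z : Arm × Bool), h = h'.push z :=
  ⟨Fin.init h, h (Fin.last t), (Fin.snoc_init_self (α := fun _ => Arm × Bool) h).symm⟩

lemma History.sum_push {t : ℕ} (φ : Arm × Bool → ℝ) (h : History t) (z : Arm × Bool) :
    ∑ s, φ (h.push z s) = ∑ s, φ (h s) + φ z := by
  simp [Fin.sum_univ_castSucc]

lemma History.prod_push {t : ℕ} (ψ : Arm × Bool → ℝ) (h : History t) (z : Arm × Bool) :
    ∏ s, ψ (h.push z s) = (∏ s, ψ (h s)) * ψ z := by
  simp [Fin.prod_univ_castSucc]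

lemma card_filter_push {t : ℕ} (P : Arm × Bool → Prop) [DecidablePred P] (h : History t)
    (z : Arm × Bool) :
    (Finset.univ.filter fun s => P (h.push z s)).card =
      (Finset.univ.filter fun s => P (h s)).card + if P z then 1 else 0 := by
  simp only [Finset.card_filter, Fin.sum_univ_castSucc, Fin.snoc_castSucc, Fin.snoc_last]

/-- A function of arm and reward whose mean is zero under each arm has cumulated
mean zero, whatever the sampling rule: its partial sums form a martingale. -/
lemma Algorithm.sum_historyProb_mul_sum_eq_zero (alg : Algorithm) (μ : Means) (T : ℕ)
    (φ : Arm × Bool → ℝ) (hφ : ∀ k, ∑ x, rewardProb (μ k) x * φ (k, x) = 0) (t : ℕ) :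
    ∑ h, alg.historyProb μ T t h * ∑ s, φ (h s) = 0 := by
  induction t with
  | zero => simp
  | succ t ih =>
    rw [sum_history_succ, ← ih]
    refine Finset.sum_congr rfl fun h _ => ?_
    have h1 : ∑ z : Arm × Bool, alg.sampleProb T h z.1 * rewardProb (μ z.1) z.2 = 1 := by
      rw [Fintype.sum_prod_type, ← alg.sum_sampleProb T h]
      refine Finset.sum_congr rfl fun k _ => ?_
      dsimp only
      simp only [← Finset.mul_sum, rewardProb, sum_toReal_pmf, mul_one]
    have h2 : ∑ z : Arm × Bool, alg.sampleProb T h z.1 * rewardProb (μ z.1) z.2 * φ z = 0 := by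
      rw [Fintype.sum_prod_type]
      refine Finset.sum_eq_zero fun k _ => ?_
      simp only [mul_assoc]
      rw [← Finset.mul_sum, hφ, mul_zero]
    simp only [alg.historyProb_push, h.sum_push φ]
    calc _ = ∑ z : Arm × Bool, (alg.historyProb μ T t h * (∑ s, φ (h s)) *
              (alg.sampleProb T h z.1 * rewardProb (μ z.1) z.2) +
            alg.historyProb μ T t h *
              (alg.sampleProb T h z.1 * rewardProb (μ z.1) z.2 * φ z)) :=
          Finset.sum_congr rfl fun z _ => by ring
      _ = _ := by rw [Finset.sum_add_distrib, ← Finset.mul_sum, ← Finset.mul_sum, h1, h2]; ring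

/-! ### Change of measure -/

/-- The Kullback–Leibler divergence between the Bernoulli distributions of means `p` and `q`;
meaningful for `p` and `q` in the open unit interval. -/
noncomputable def bernoulliKL (p q : ℝ) : ℝ :=
  p * (Real.log p - Real.log q) + (1 - p) * (Real.log (1 - p) - Real.log (1 - q))

/-- The log-likelihood ratio of one observation, for the instance `π` against `μ`. -/
noncomputable def logRatio (π μ : Means) (z : Arm × Bool) : ℝ :=
  Real.log (rewardProb (π z.1) z.2) - Real.log (rewardProb (μ z.1) z.2)

lemma rewardProb_pos {μ : Means} (hμ : μ ∈ instances) (k : Arm) (x : Bool) :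
    0 < rewardProb (μ k) x := by
  cases x
  · rw [rewardProb_false]; linarith [(hμ.1 k).2]
  · rw [rewardProb_true]; exact (hμ.1 k).1

lemma Algorithm.historyProb_eq_mul_exp (alg : Algorithm) {π μ : Means} (hπ : π ∈ instances)
    (hμ : μ ∈ instances) (T t : ℕ) (h : History t) :
    alg.historyProb μ T t h =
      alg.historyProb π T t h * Real.exp (-∑ s, logRatio π μ (h s)) := by
  induction t with
  | zero => simp [historyProb, historyLaw]
  | succ t ih =>
    obtain ⟨h, z, rfl⟩ := h.exists_push
    have key : rewardProb (μ z.1) z.2 =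
        rewardProb (π z.1) z.2 * Real.exp (-logRatio π μ z) := by
      rw [logRatio, neg_sub, Real.exp_sub, Real.exp_log (rewardProb_pos hμ _ _),
        Real.exp_log (rewardProb_pos hπ _ _)]
      field_simp [(rewardProb_pos hπ z.1 z.2).ne']
    rw [alg.historyProb_push, alg.historyProb_push, h.sum_push, neg_add, Real.exp_add, ih h, key]
    ring

/-- The divergence between the laws of the observations on two instances is the sum over the
arms of the divergence of one reward times the expected number of pulls. -/
lemma Algorithm.sum_historyProb_mul_sum_logRatio (alg : Algorithm) (π μ : Means) (T t : ℕ) :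
    ∑ h, alg.historyProb π T t h * ∑ s, logRatio π μ (h s) =
      ∑ h : History t, alg.historyProb π T t h *
        ∑ k, bernoulliKL (π k) (μ k) * (pulls h k : ℝ) := by
  have h0 := alg.sum_historyProb_mul_sum_eq_zero π T
    (fun z => logRatio π μ z - bernoulliKL (π z.1) (μ z.1)) (fun k => by
      simp only [Fintype.sum_bool, logRatio, rewardProb_true, rewardProb_false, bernoulliKL]
      ring) t
  rw [← sub_eq_zero, ← Finset.sum_sub_distrib, ← h0]
  refine Finset.sum_congr rfl fun h _ => ?_
  have : ∑ s, bernoulliKL (π (h s).1) (μ (h s).1) =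
      ∑ k, bernoulliKL (π k) (μ k) * (pulls h k : ℝ) := by
    rw [← Finset.sum_fiberwise Finset.univ (fun s => (h s).1)]
    refine Finset.sum_congr rfl fun k _ => ?_
    rw [Finset.sum_congr rfl (g := fun _ => bernoulliKL (π k) (μ k)) fun s hs => by
      rw [(Finset.mem_filter.1 hs).2], Finset.sum_const, nsmul_eq_mul, mul_comm, pulls]
  rw [Finset.sum_sub_distrib, this, mul_sub]

lemma pulls_zero_add_pulls_one {t : ℕ} (h : History t) : pulls h 0 + pulls h 1 = t := by
  induction t with
  | zero => simp [pulls]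
  | succ t ih =>
    obtain ⟨h, ⟨k, x⟩, rfl⟩ := h.exists_push
    have := ih h
    simp only [pulls] at this ⊢
    rw [card_filter_push (fun z => z.1 = 0), card_filter_push (fun z => z.1 = 1)]
    fin_cases k <;> simp <;> omega

/-- The probability that arm `k` is recommended, as a real number. -/
noncomputable def Algorithm.decisionProb (alg : Algorithm) (μ : Means) (T : ℕ) (k : Arm) : ℝ :=
  (alg.decisionLaw μ T k).toReal

lemma Algorithm.sum_decisionProb (alg : Algorithm) (μ : Means) (T : ℕ) :
    ∑ k, alg.decisionProb μ T k = 1 := sum_toReal_pmf _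

lemma Algorithm.decisionProb_eq_sum (alg : Algorithm) (μ : Means) (T : ℕ) (k : Arm) :
    alg.decisionProb μ T k =
      ∑ h, alg.historyProb μ T T h * (alg.decide T h k).toReal := by
  rw [decisionProb, decisionLaw, PMF.bind_apply, tsum_fintype, ENNReal.toReal_sum]
  · simp only [ENNReal.toReal_mul, historyProb]
  · exact fun h _ => ENNReal.mul_ne_top (PMF.apply_ne_top _ _) (PMF.apply_ne_top _ _)

lemma Algorithm.sum_historyProb_mul_pulls (alg : Algorithm) (π : Means) (T : ℕ) (d : Arm → ℝ) :
    ∑ h : History T, alg.historyProb π T T h * ∑ k, d k * (pulls h k : ℝ) =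
      T * ((1 - alg.expectedProportion π T 1) * d 0 + alg.expectedProportion π T 1 * d 1) := by
  rcases T.eq_zero_or_pos with rfl | hT
  · simp [pulls]
  have hT' : (T : ℝ) ≠ 0 := by positivity
  have hw : T * alg.expectedProportion π T 1 =
      ∑ h : History T, alg.historyProb π T T h * (pulls h 1 : ℝ) := by
    rw [expectedProportion, Finset.mul_sum]
    refine Finset.sum_congr rfl fun h _ => ?_
    rw [historyProb, proportion]
    field_simp
  have hp : ∀ h : History T, (pulls h 0 : ℝ) = T - pulls h 1 := fun h => by
    rw [eq_sub_iff_add_eq]; exact_mod_cast pulls_zero_add_pulls_one h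
  calc _ = ∑ h : History T, (T * d 0 * alg.historyProb π T T h +
        (d 1 - d 0) * (alg.historyProb π T T h * (pulls h 1 : ℝ))) :=
        Finset.sum_congr rfl fun h _ => by rw [Fin.sum_univ_two, hp]; ring
    _ = T * d 0 * 1 + (d 1 - d 0) * (T * alg.expectedProportion π T 1) := by
        rw [Finset.sum_add_distrib, ← Finset.mul_sum, ← Finset.mul_sum, alg.sum_historyProb, hw]
    _ = _ := by ring

lemma Algorithm.expectedProportion_mem (alg : Algorithm) (π : Means) (T : ℕ) :
    alg.expectedProportion π T 1 ∈ Set.Icc (0 : ℝ) 1 := by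
  have h0 : ∀ h : History T, 0 ≤ proportion h 1 := fun h => by unfold proportion; positivity
  have h1 : ∀ h : History T, proportion h 1 ≤ 1 := fun h =>
    div_le_one_of_le₀ (by exact_mod_cast (by have := pulls_zero_add_pulls_one h; omega))
      (by positivity)
  refine ⟨Finset.sum_nonneg fun h _ => mul_nonneg ENNReal.toReal_nonneg (h0 h), ?_⟩
  rw [← alg.sum_historyProb π T T]
  exact Finset.sum_le_sum fun h _ => mul_le_of_le_one_right ENNReal.toReal_nonneg (h1 h)

/-- Change of measure: an arm that is recommended with probability at most `exp (-b T)` on `μ` is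
recommended on `π` only if the divergence between the laws of the observations is at
least about `b T`. This is the Donsker–Varadhan inequality for the function that equals `b T` if
arm `k` is recommended and `0` otherwise. -/
theorem Algorithm.decisionProb_mul_le (alg : Algorithm) {π μ : Means} (hπ : π ∈ instances)
    (hμ : μ ∈ instances) (T : ℕ) (k : Arm) (b : ℝ)
    (hb : alg.decisionProb μ T k ≤ Real.exp (-(b * T))) :
    alg.decisionProb π T k * (b * T) ≤
      T * ((1 - alg.expectedProportion π T 1) * bernoulliKL (π 0) (μ 0) +
        alg.expectedProportion π T 1 * bernoulliKL (π 1) (μ 1)) + Real.log 2 := by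
  rw [← alg.sum_historyProb_mul_pulls π T fun k => bernoulliKL (π k) (μ k),
    ← alg.sum_historyProb_mul_sum_logRatio π μ T T]
  set P := alg.historyProb π T T
  set Λ : History T → ℝ := fun h => ∑ s, logRatio π μ (h s)
  set D : History T → Arm → ℝ := fun h j => (alg.decide T h j).toReal
  set g : Arm → ℝ := fun j => if j = k then b * T else 0
  have hD : ∀ h, ∑ j, D h j = 1 := fun h => sum_toReal_pmf _
  have hP : ∑ h, P h = 1 := alg.sum_historyProb π T T
  have hQ : ∑ h, P h * Real.exp (-Λ h) = 1 := by
    rw [← alg.sum_historyProb μ T T]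
    exact Finset.sum_congr rfl fun h _ => (alg.historyProb_eq_mul_exp hπ hμ T T h).symm
  have hQk : ∑ h, P h * Real.exp (-Λ h) * D h k ≤ Real.exp (-(b * T)) := by
    refine le_trans (le_of_eq ?_) hb
    rw [alg.decisionProb_eq_sum]
    exact Finset.sum_congr rfl fun h _ => by rw [alg.historyProb_eq_mul_exp hπ hμ T T h]
  -- `log y ≤ y / 2 - 1 + log 2` at the exponentially tilted likelihood ratio
  have hlog : ∀ h j, g j - Λ h ≤ Real.exp (-Λ h) * Real.exp (g j) / 2 - 1 + Real.log 2 := by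
    intro h j
    have := Real.add_one_le_exp (g j - Λ h - Real.log 2)
    rw [Real.exp_sub, Real.exp_log two_pos, sub_eq_neg_add (g j), Real.exp_add] at this
    linarith
  have hsum : ∑ h, ∑ j, P h * D h j * (g j - Λ h) ≤
      ∑ h, ∑ j, P h * D h j * (Real.exp (-Λ h) * Real.exp (g j) / 2 - 1 + Real.log 2) :=
    Finset.sum_le_sum fun h _ => Finset.sum_le_sum fun j _ =>
      mul_le_mul_of_nonneg_left (hlog h j)
        (mul_nonneg (alg.historyProb_nonneg π T T h) ENNReal.toReal_nonneg)
  have hleft : ∑ h, ∑ j, P h * D h j * (g j - Λ h) =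
      alg.decisionProb π T k * (b * T) - ∑ h, P h * Λ h := by
    rw [alg.decisionProb_eq_sum, Finset.sum_mul, ← Finset.sum_sub_distrib]
    refine Finset.sum_congr rfl fun h _ => ?_
    calc _ = ∑ j, (P h * (D h j * g j) - P h * Λ h * D h j) :=
          Finset.sum_congr rfl fun j _ => by ring
      _ = P h * ∑ j, D h j * g j - P h * Λ h * ∑ j, D h j := by
          rw [Finset.sum_sub_distrib, ← Finset.mul_sum, ← Finset.mul_sum]
      _ = _ := by rw [hD]; simp [g, D, P]; ring
  have hexp : ∀ j, Real.exp (g j) ≤ 1 + if j = k then Real.exp (b * T) else 0 := by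
    intro j
    by_cases hj : j = k <;> simp [g, hj]
  have hright : ∑ h, ∑ j, P h * D h j *
      (Real.exp (-Λ h) * Real.exp (g j) / 2 - 1 + Real.log 2) ≤ Real.log 2 := by
    have hh : ∀ h, ∑ j, P h * D h j * (Real.exp (-Λ h) * Real.exp (g j) / 2 - 1 + Real.log 2) ≤
        P h * Real.exp (-Λ h) / 2 + P h * Real.exp (-Λ h) * D h k * (Real.exp (b * T) / 2) +
          (Real.log 2 - 1) * P h := by
      intro h
      have hPn : 0 ≤ P h := alg.historyProb_nonneg π T T h
      calc _ ≤ ∑ j, P h * D h j * (Real.exp (-Λ h) *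
              (1 + if j = k then Real.exp (b * T) else 0) / 2 - 1 + Real.log 2) := by
            refine Finset.sum_le_sum fun j _ => mul_le_mul_of_nonneg_left ?_
              (mul_nonneg hPn ENNReal.toReal_nonneg)
            gcongr
            exact hexp j
        _ = (P h * Real.exp (-Λ h) / 2 + (Real.log 2 - 1) * P h) * ∑ j, D h j +
              P h * Real.exp (-Λ h) / 2 *
                ∑ j, D h j * if j = k then Real.exp (b * T) else 0 := by
            rw [Finset.mul_sum, Finset.mul_sum, ← Finset.sum_add_distrib]
            exact Finset.sum_congr rfl fun j _ => by ring
        _ = _ := by rw [hD]; simp; ring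
    refine (Finset.sum_le_sum fun h _ => hh h).trans ?_
    rw [Finset.sum_add_distrib, Finset.sum_add_distrib, ← Finset.sum_div, ← Finset.sum_mul,
      ← Finset.mul_sum, hQ, hP]
    have := mul_le_mul_of_nonneg_right hQk (Real.exp_nonneg (b * T))
    rw [← Real.exp_add, neg_add_cancel, Real.exp_zero] at this
    linarith
  linarith

/-! ### Quadratic bound on the Bernoulli divergence -/

lemma bernoulliKL_le_of_le {p q c : ℝ} (hp : 0 < p) (hpq : p ≤ q) (hq : q < 1) (hc : 0 < c)
    (h : ∀ x ∈ Set.Icc p q, c ≤ x * (1 - x)) :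
    bernoulliKL p q ≤ (p - q) ^ 2 / (2 * c) := by
  set f : ℝ → ℝ := fun x => (x - p) ^ 2 / (2 * c) + p * Real.log x + (1 - p) * Real.log (1 - x)
  have hd : ∀ x ∈ Set.Icc p q, HasDerivAt f ((x - p) / c - (x - p) / (x * (1 - x))) x := by
    intro x hx
    have hx0 : x ≠ 0 := by linarith [hx.1]
    have hx1 : 1 - x ≠ 0 := by linarith [hx.2]
    have h1 : HasDerivAt (fun x : ℝ => (x - p) ^ 2 / (2 * c)) ((x - p) / c) x := by
      have := (((hasDerivAt_id x).sub_const p).pow 2).div_const (2 * c)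
      exact this.congr_deriv (by simp only [id, Nat.cast_ofNat, mul_one]; field_simp; norm_num)
    have h2 := (Real.hasDerivAt_log hx0).const_mul p
    have h3 := ((((hasDerivAt_id x).const_sub 1).log hx1)).const_mul (1 - p)
    refine ((h1.add h2).add h3).congr_deriv ?_
    simp only [id]
    field_simp
    ring
  have hmono : MonotoneOn f (Set.Icc p q) := by
    refine monotoneOn_of_deriv_nonneg (convex_Icc p q)
      (fun x hx => (hd x hx).continuousAt.continuousWithinAt)
      (fun x hx => (hd x (interior_subset hx)).differentiableAt.differentiableWithinAt) ?_
    intro x hx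
    have hx := interior_subset hx
    rw [(hd x hx).deriv, sub_nonneg]
    exact div_le_div_of_nonneg_left (by linarith [hx.1]) hc (h x hx)
  have := hmono (Set.left_mem_Icc.2 hpq) (Set.right_mem_Icc.2 hpq) hpq
  simp only [f, sub_self, ne_eq, OfNat.ofNat_ne_zero, not_false_eq_true, zero_pow, zero_div,
    zero_add] at this
  rw [bernoulliKL, show (p - q) ^ 2 = (q - p) ^ 2 by ring]
  linarith

/-- The divergence is at most half the squared difference of the means over a lower bound
`c` of the variances between them: its second derivative in `q` at `q = p` is
the inverse of the variance. -/
lemma bernoulliKL_le {p q c : ℝ} (hp : p ∈ Set.Ioo (0 : ℝ) 1) (hq : q ∈ Set.Ioo (0 : ℝ) 1)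
    (hc : 0 < c) (h : ∀ x ∈ Set.uIcc p q, c ≤ x * (1 - x)) :
    bernoulliKL p q ≤ (p - q) ^ 2 / (2 * c) := by
  rcases le_total p q with hpq | hpq
  · rw [Set.uIcc_of_le hpq] at h
    exact bernoulliKL_le_of_le hp.1 hpq hq.2 hc h
  · rw [Set.uIcc_of_ge hpq] at h
    -- exchange the roles of the two rewards
    have := bernoulliKL_le_of_le (p := 1 - p) (q := 1 - q) (c := c) (by linarith [hp.2])
      (by linarith) (by linarith [hq.1]) hc fun x hx => by
        have := h (1 - x) ⟨by linarith [hx.2], by linarith [hx.1]⟩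
        linarith
    rw [bernoulliKL, show 1 - (1 - p) = p by ring, show 1 - (1 - q) = q by ring] at this
    rw [bernoulliKL, show (p - q) ^ 2 = (1 - p - (1 - q)) ^ 2 by ring]
    linarith

/-! ### Exponential rates -/

lemma eventually_le_of_lt_liminf {p : ℕ → ℝ≥0∞} {b : ℝ}
    (h : (b : EReal) < liminf (fun T : ℕ => -ENNReal.log (p T) / (T : EReal)) atTop) :
    ∀ᶠ T : ℕ in atTop, p T ≤ ENNReal.ofReal (Real.exp (-(b * T))) := by
  filter_upwards [eventually_lt_of_lt_liminf h, eventually_gt_atTop 0] with T hT hpos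
  rw [EReal.lt_div_iff (by exact_mod_cast hpos) (by exact_mod_cast EReal.coe_ne_top T)] at hT
  rw [← ENNReal.log_le_log_iff, ENNReal.log_ofReal, if_neg (Real.exp_pos _).not_ge, Real.log_exp,
    ← EReal.neg_le_neg_iff]
  refine le_trans (le_of_eq ?_) hT.le
  simp

lemma le_liminf_of_eventually_le {p : ℕ → ℝ≥0∞} {B C : ℝ} (hC : 0 < C)
    (h : ∀ᶠ T : ℕ in atTop, p T ≤ ENNReal.ofReal (C * Real.exp (-(B * T)))) :
    (B : EReal) ≤ liminf (fun T : ℕ => -ENNReal.log (p T) / (T : EReal)) atTop := by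
  refine le_of_forall_lt_imp_le_of_dense fun b' hb' => ?_
  induction b' with
  | bot => exact bot_le
  | top => simp at hb'
  | coe b =>
  have hb : b < B := by exact_mod_cast hb'
  refine le_liminf_of_le (by isBoundedDefault) ?_
  have hlarge : ∀ᶠ T : ℕ in atTop, Real.log C ≤ (B - b) * T :=
    (tendsto_natCast_atTop_atTop.const_mul_atTop (sub_pos.2 hb)).eventually_ge_atTop _
  filter_upwards [h, hlarge, eventually_gt_atTop 0] with T hT hl hpos
  rw [EReal.le_div_iff_mul_le (by exact_mod_cast hpos) (by exact_mod_cast EReal.coe_ne_top T)]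
  rw [← ENNReal.log_le_log_iff, ENNReal.log_ofReal, if_neg (mul_pos hC (Real.exp_pos _)).not_ge,
    Real.log_mul hC.ne' (Real.exp_pos _).ne', Real.log_exp, ← EReal.neg_le_neg_iff] at hT
  refine le_trans ?_ hT
  have : b * T ≤ -(Real.log C + -(B * T)) := by linarith
  exact_mod_cast this

/-! ### The error probability of uniform sampling -/

lemma uniformSampling_sampleProb (T : ℕ) {t : ℕ} (h : History t) (k : Arm) :
    uniformSampling.sampleProb T h k = if k = (if Even t then 0 else 1) then 1 else 0 := by
  simp only [Algorithm.sampleProb, uniformSampling, PMF.pure_apply]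
  split_ifs <;> simp

/-- Under uniform sampling the arms are pulled in a fixed order, so the observations are
independent and the expectation of a product over the rounds factorizes. -/
lemma sum_historyProb_mul_prod_uniform (μ : Means) (T : ℕ) (ψ : Arm × Bool → ℝ) (t : ℕ) :
    ∑ h, uniformSampling.historyProb μ T t h * ∏ s, ψ (h s) =
      (∑ x, rewardProb (μ 0) x * ψ (0, x)) ^ ((t + 1) / 2) *
        (∑ x, rewardProb (μ 1) x * ψ (1, x)) ^ (t / 2) := by
  induction t with
  | zero => simpa using uniformSampling.sum_historyProb μ T 0
  | succ t ih =>
    rw [sum_history_succ]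
    have hstep : ∀ h : History t, ∑ z : Arm × Bool,
        uniformSampling.historyProb μ T (t + 1) (h.push z) * ∏ s, ψ (h.push z s) =
        uniformSampling.historyProb μ T t h * (∏ s, ψ (h s)) *
          ∑ x, rewardProb (μ (if Even t then 0 else 1)) x * ψ (if Even t then 0 else 1, x) := by
      intro h
      rw [Fintype.sum_prod_type, Finset.sum_eq_single (if Even t then (0 : Arm) else 1)]
      · rw [Finset.mul_sum]
        refine Finset.sum_congr rfl fun x _ => ?_
        rw [Algorithm.historyProb_push, h.prod_push, uniformSampling_sampleProb, if_pos rfl]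
        ring
      · intro k _ hk
        refine Finset.sum_eq_zero fun x _ => ?_
        rw [Algorithm.historyProb_push, uniformSampling_sampleProb, if_neg hk]
        ring
      · simp
    rw [Finset.sum_congr rfl fun h _ => hstep h, ← Finset.sum_mul, ih]
    rcases Nat.even_or_odd t with he | ho
    · rw [if_pos he]
      obtain ⟨m, rfl⟩ := he
      rw [show (m + m + 1 + 1) / 2 = m + 1 by omega, show (m + m + 1) / 2 = m by omega,
        show (m + m) / 2 = m by omega]
      ring
    · rw [if_neg (Nat.not_even_iff_odd.2 ho)]
      obtain ⟨m, rfl⟩ := ho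
      rw [show (2 * m + 1 + 1 + 1) / 2 = m + 1 by omega, show (2 * m + 1 + 1) / 2 = m + 1 by omega,
        show (2 * m + 1) / 2 = m by omega]
      ring

lemma pulls_push {t : ℕ} (h : History t) (z : Arm × Bool) (j : Arm) :
    pulls (h.push z) j = pulls h j + if z.1 = j then 1 else 0 :=
  card_filter_push (fun z => z.1 = j) h z

lemma totalReward_push {t : ℕ} (h : History t) (z : Arm × Bool) (j : Arm) :
    totalReward (h.push z) j = totalReward h j + if z = (j, true) then 1 else 0 :=
  card_filter_push (fun z => z = (j, true)) h z

lemma totalReward_le_pulls {t : ℕ} (h : History t) (k : Arm) : totalReward h k ≤ pulls h k :=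
  Finset.card_le_card fun s hs => by
    simp only [Finset.mem_filter, Finset.mem_univ, true_and] at hs ⊢
    rw [hs]

lemma pulls_uniformSampling {μ : Means} {T t : ℕ} {h : History t}
    (hh : uniformSampling.historyProb μ T t h ≠ 0) :
    pulls h 0 = (t + 1) / 2 ∧ pulls h 1 = t / 2 := by
  induction t with
  | zero => simp [pulls]
  | succ t ih =>
    obtain ⟨h, z, rfl⟩ := h.exists_push
    rw [Algorithm.historyProb_push, uniformSampling_sampleProb] at hh
    obtain ⟨h0, h1⟩ := ih (left_ne_zero_of_mul hh)
    have hz : z.1 = if Even t then 0 else 1 := by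
      by_contra hz
      simp [hz] at hh
    rw [pulls_push, pulls_push, h0, h1, hz]
    rcases Nat.even_or_odd t with he | ho
    · obtain ⟨m, rfl⟩ := he
      simp
      omega
    · rw [if_neg (Nat.not_even_iff_odd.2 ho)]
      obtain ⟨m, rfl⟩ := ho
      simp
      omega

/-- The weight `r` for a reward from the second arm and `r⁻¹` for a reward from the first;
its product over the rounds is `r` to the difference of the total rewards. -/
noncomputable def tilt (r : ℝ) (z : Arm × Bool) : ℝ :=
  if z.2 then (if z.1 = 0 then r⁻¹ else r) else 1

lemma prod_tilt {r : ℝ} (hr : 0 < r) {t : ℕ} (h : History t) :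
    ∏ s, tilt r (h s) = r ^ totalReward h 1 / r ^ totalReward h 0 := by
  induction t with
  | zero => simp [totalReward]
  | succ t ih =>
    obtain ⟨h, ⟨k, x⟩, rfl⟩ := h.exists_push
    rw [h.prod_push, ih h, totalReward_push, totalReward_push]
    fin_cases k <;> cases x <;> simp [tilt, pow_succ] <;> field_simp

lemma Arm.eq_of_ne_of_ne : ∀ {i k j : Arm}, k ≠ j → i ≠ k → i = j := by decide

lemma ne_of_lt_means {μ : Means} {k j : Arm} (h : μ k < μ j) : k ≠ j :=
  fun hkj => h.ne (congrArg μ hkj)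

lemma Algorithm.errorProb_eq (alg : Algorithm) {μ : Means} {k j : Arm} (h : μ k < μ j) (T : ℕ) :
    alg.errorProb μ T = ENNReal.ofReal (alg.decisionProb μ T k) := by
  have hset : {i | ∃ j, μ i < μ j} = {k} := by
    ext i
    constructor
    · rintro ⟨l, hl⟩
      by_contra hi
      have h1 : i = j := Arm.eq_of_ne_of_ne (ne_of_lt_means h) hi
      have h2 : l = k := by
        subst h1
        exact Arm.eq_of_ne_of_ne (ne_of_lt_means h).symm (ne_of_lt_means hl).symm
      subst h1 h2
      exact lt_asymm h hl
    · rintro rfl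
      exact ⟨j, h⟩
  rw [errorProb, hset, PMF.toMeasure_apply_singleton _ _ (measurableSet_singleton k),
    decisionProb, ENNReal.ofReal_toReal (PMF.apply_ne_top _ _)]

/-- Chernoff bound for uniform sampling, for an arm `k` that is not the best. The tilt `r` favours
the worse arm, so a wrong recommendation makes the product of the weights
at least `(1 + r)⁻¹`; the constant absorbs the extra pull of the first arm at odd budgets. -/
lemma decisionProb_uniformSampling_le {μ : Means} {k j : Arm} (h : μ k < μ j) {r : ℝ} (hr : 0 < r)
    (hlt : μ 0 < μ 1 → r ≤ 1) (hgt : μ 1 < μ 0 → 1 ≤ r) {T : ℕ} (hT : 2 ≤ T) :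
    uniformSampling.decisionProb μ T k ≤
      (1 + r) * ((μ 0 * r⁻¹ + (1 - μ 0)) ^ ((T + 1) / 2) *
        (μ 1 * r + (1 - μ 1)) ^ (T / 2)) := by
  have hM := sum_historyProb_mul_prod_uniform μ T (tilt r) T
  simp only [Fintype.sum_bool, rewardProb_true, rewardProb_false, tilt] at hM
  simp only [if_true, one_ne_zero, if_false, Bool.false_eq_true, mul_one] at hM
  rw [← hM, Algorithm.decisionProb_eq_sum, Finset.mul_sum]
  refine Finset.sum_le_sum fun x _ => ?_
  change _ ≤ (1 + r) * (_ * ∏ s, tilt r (x s))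
  rw [prod_tilt hr]
  have hP := uniformSampling.historyProb_nonneg μ T T x
  rcases hP.eq_or_lt with h0 | hpos
  · rw [← h0]; simp
  rw [mul_left_comm]
  refine mul_le_mul_of_nonneg_left ?_ hP
  have hpow : ∀ n : ℕ, 0 < r ^ n := fun n => pow_pos hr n
  simp only [uniformSampling, PMF.pure_apply]
  by_cases hd : k = if empiricalMean x 0 < empiricalMean x 1 then 1 else 0
  swap
  · rw [if_neg hd, ENNReal.toReal_zero]
    have := hpow (totalReward x 0)
    have := hpow (totalReward x 1)
    positivity
  rw [if_pos hd, ENNReal.toReal_one, ← mul_div_assoc, one_le_div (hpow _)]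
  obtain ⟨n0, n1⟩ := pulls_uniformSampling hpos.ne'
  have hn1 : 0 < pulls x 1 := by omega
  have hn0 : 0 < pulls x 0 := by omega
  have hn01 : (pulls x 1 : ℝ) ≤ pulls x 0 := by exact_mod_cast (by omega)
  have hn10 : (pulls x 0 : ℝ) ≤ pulls x 1 + 1 := by exact_mod_cast (by omega)
  have hn1' : (0 : ℝ) < pulls x 1 := by exact_mod_cast hn1
  have hn0' : (0 : ℝ) < pulls x 0 := by exact_mod_cast hn0
  simp only [empiricalMean, div_lt_div_iff₀ hn0' hn1'] at hd
  split_ifs at hd with hem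
  · subst hd
    have hj : j = 0 := Arm.eq_of_ne_of_ne (k := 1) (by decide) (ne_of_lt_means h).symm
    subst hj
    have hS : totalReward x 0 ≤ totalReward x 1 + 1 := by
      have h1 : (totalReward x 1 : ℝ) ≤ pulls x 1 := by exact_mod_cast totalReward_le_pulls x 1
      have h2 : (totalReward x 0 : ℝ) * pulls x 1 < (totalReward x 1 + 1) * pulls x 1 := by
        nlinarith [mul_le_mul_of_nonneg_left hn10 (Nat.cast_nonneg (α := ℝ) (totalReward x 1))]
      have h3 := lt_of_mul_lt_mul_right h2 hn1'.le
      exact_mod_cast h3.le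
    calc r ^ totalReward x 0 ≤ r ^ (totalReward x 1 + 1) := pow_le_pow_right₀ (hgt h) hS
      _ = r * r ^ totalReward x 1 := pow_succ' _ _
      _ ≤ (1 + r) * r ^ totalReward x 1 := by gcongr; linarith
  · subst hd
    have hj : j = 1 := Arm.eq_of_ne_of_ne (k := 0) (by decide) (ne_of_lt_means h).symm
    subst hj
    have hS : totalReward x 1 ≤ totalReward x 0 := by
      have h2 : (totalReward x 1 : ℝ) * pulls x 0 ≤ totalReward x 0 * pulls x 0 :=
        (not_lt.1 hem).trans (by gcongr)
      exact_mod_cast le_of_mul_le_mul_right h2 hn0'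
    calc r ^ totalReward x 0 ≤ r ^ totalReward x 1 := pow_le_pow_of_le_one hr.le (hlt h) hS
      _ ≤ (1 + r) * r ^ totalReward x 1 := le_mul_of_one_le_left (hpow _).le (by linarith)

/-- A lower bound for the error exponent of uniform sampling that is sharp to second order in
the gap between the means. -/
noncomputable def rateBound (x y : ℝ) : ℝ :=
  (x - y) ^ 2 / (4 * (x * (1 - y) + y * (1 - x)))

lemma exists_mem_lt {μ : Means} (hμ : μ ∈ instances) : ∃ k j, μ k < μ j := by
  rcases lt_or_gt_of_ne hμ.2 with h | h
  exacts [⟨_, _, h⟩, ⟨_, _, h⟩]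

lemma rateBound_pos {μ : Means} (hμ : μ ∈ instances) : 0 < rateBound (μ 0) (μ 1) := by
  have h0 := hμ.1 0
  have h1 := hμ.1 1
  have hne : (μ 0 : ℝ) - μ 1 ≠ 0 := sub_ne_zero.2 fun h => hμ.2 (Subtype.ext h)
  have := mul_pos h0.1 (sub_pos.2 h1.2)
  have := mul_pos h1.1 (sub_pos.2 h0.2)
  unfold rateBound
  positivity

/-- With `u = μ₁(1 - μ₂)` and `v = μ₂(1 - μ₁)`, the tilt `√u / √v` is the one that minimizes
the Chernoff bound. -/
lemma tilt_optimal {x y : ℝ} (hx : x ∈ Set.Ioo (0 : ℝ) 1) (hy : y ∈ Set.Ioo (0 : ℝ) 1) :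
    (x * (√(x * (1 - y)) / √(y * (1 - x)))⁻¹ + (1 - x)) *
      (y * (√(x * (1 - y)) / √(y * (1 - x))) + (1 - y)) ≤ 1 - 2 * rateBound x y := by
  have hu : 0 < x * (1 - y) := mul_pos hx.1 (sub_pos.2 hy.2)
  have hv : 0 < y * (1 - x) := mul_pos hy.1 (sub_pos.2 hx.2)
  set p := √(x * (1 - y))
  set q := √(y * (1 - x))
  have hp : 0 < p := Real.sqrt_pos.2 hu
  have hq : 0 < q := Real.sqrt_pos.2 hv
  have hp2 : p ^ 2 = x * (1 - y) := Real.sq_sqrt hu.le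
  have hq2 : q ^ 2 = y * (1 - x) := Real.sq_sqrt hv.le
  have h1 : (x * (p / q)⁻¹ + (1 - x)) * (y * (p / q) + (1 - y)) = 1 - (p - q) ^ 2 := by
    have e : (x * (p / q)⁻¹ + (1 - x)) * (y * (p / q) + (1 - y)) =
        x * y + (1 - x) * (1 - y) + x * (1 - y) * (q / p) + y * (1 - x) * (p / q) := by
      field_simp
      ring
    rw [e, ← hp2, ← hq2, show p ^ 2 * (q / p) = p * q by field_simp,
      show q ^ 2 * (p / q) = p * q by field_simp]
    linear_combination hp2 + hq2
  have h2 : 2 * rateBound x y ≤ (p - q) ^ 2 := by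
    rw [rateBound, ← hp2, ← hq2, show x - y = p ^ 2 - q ^ 2 by rw [hp2, hq2]; ring,
      ← mul_div_assoc, div_le_iff₀ (by positivity)]
    nlinarith [mul_nonneg (sq_nonneg (p - q)) (sq_nonneg (p - q))]
  rw [h1]
  linarith

theorem rateBound_le_errorExponent {μ : Means} (hμ : μ ∈ instances) :
    (rateBound (μ 0) (μ 1) : EReal) ≤ uniformSampling.errorExponent μ := by
  have h0 := hμ.1 0
  have h1 := hμ.1 1
  have hu : 0 < (μ 0 : ℝ) * (1 - μ 1) := mul_pos h0.1 (sub_pos.2 h1.2)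
  have hv : 0 < (μ 1 : ℝ) * (1 - μ 0) := mul_pos h1.1 (sub_pos.2 h0.2)
  have hM := tilt_optimal h0 h1
  set B := rateBound (μ 0) (μ 1)
  have hB : 0 < B := rateBound_pos hμ
  set r := √((μ 0 : ℝ) * (1 - μ 1)) / √((μ 1 : ℝ) * (1 - μ 0)) with hr_def
  have hr : 0 < r := div_pos (Real.sqrt_pos.2 hu) (Real.sqrt_pos.2 hv)
  set M := (μ 0 : ℝ) * r⁻¹ + (1 - μ 0)
  set N := (μ 1 : ℝ) * r + (1 - μ 1)
  have hM0 : 0 < M := add_pos (mul_pos h0.1 (inv_pos.2 hr)) (sub_pos.2 h0.2)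
  have hN0 : 0 < N := add_pos (mul_pos h1.1 hr) (sub_pos.2 h1.2)
  obtain ⟨k, j, hkj⟩ := exists_mem_lt hμ
  refine le_liminf_of_eventually_le (C := (1 + r) * ((1 + M) * Real.exp B)) (by positivity) ?_
  filter_upwards [eventually_ge_atTop 2] with T hT
  rw [uniformSampling.errorProb_eq hkj]
  refine ENNReal.ofReal_le_ofReal ?_
  refine (decisionProb_uniformSampling_le hkj hr (fun h => ?_) (fun h => ?_) hT).trans ?_
  · have h : (μ 0 : ℝ) < μ 1 := h
    exact div_le_one_of_le₀ (Real.sqrt_le_sqrt (by nlinarith)) (Real.sqrt_nonneg _)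
  · have h : (μ 1 : ℝ) < μ 0 := h
    exact (one_le_div (Real.sqrt_pos.2 hv)).2 (Real.sqrt_le_sqrt (by nlinarith))
  rw [mul_assoc (1 + r)]
  refine mul_le_mul_of_nonneg_left ?_ (by positivity)
  have hpow : M ^ ((T + 1) / 2) ≤ (1 + M) * M ^ (T / 2) := by
    rcases (show (T + 1) / 2 = T / 2 ∨ (T + 1) / 2 = T / 2 + 1 by omega) with e | e
    · rw [e]
      exact le_mul_of_one_le_left (by positivity) (by linarith)
    · rw [e, pow_succ']
      gcongr
      linarith
  have hMN : M * N ≤ Real.exp (-(2 * B)) :=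
    hM.trans (by linarith [Real.add_one_le_exp (-(2 * B))])
  have hTB : B * T ≤ B * (2 * (T / 2 : ℕ) + 1) :=
    mul_le_mul_of_nonneg_left (by exact_mod_cast (by omega)) hB.le
  calc M ^ ((T + 1) / 2) * N ^ (T / 2) ≤ (1 + M) * M ^ (T / 2) * N ^ (T / 2) := by gcongr
    _ = (1 + M) * (M * N) ^ (T / 2) := by rw [mul_pow]; ring
    _ ≤ (1 + M) * Real.exp (-(2 * B)) ^ (T / 2) := by gcongr
    _ ≤ (1 + M) * Real.exp (B + -(B * T)) := by
        rw [← Real.exp_nat_mul]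
        gcongr
        linarith
    _ = _ := by rw [Real.exp_add]; ring

lemma Algorithm.decisionProb_nonneg (alg : Algorithm) (μ : Means) (T : ℕ) (k : Arm) :
    0 ≤ alg.decisionProb μ T k := ENNReal.toReal_nonneg

lemma Algorithm.decisionProb_add (alg : Algorithm) {k j : Arm} (hkj : k ≠ j) (μ : Means) (T : ℕ) :
    alg.decisionProb μ T k + alg.decisionProb μ T j = 1 := by
  rw [← alg.sum_decisionProb μ T, ← Finset.sum_pair hkj]
  congr 1
  ext i
  simp only [Finset.mem_insert, Finset.mem_singleton, Finset.mem_univ, iff_true]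
  exact or_iff_not_imp_left.2 (Arm.eq_of_ne_of_ne hkj)

/-! ### Consistency -/

namespace Algorithm.PerformsAsWellAsUniform

variable {alg : Algorithm}

lemma eventually_errorProb_le (h : alg.PerformsAsWellAsUniform) {μ : Means} (hμ : μ ∈ instances)
    {b : ℝ} (hb : b < rateBound (μ 0) (μ 1)) :
    ∀ᶠ T : ℕ in atTop, alg.errorProb μ T ≤ ENNReal.ofReal (Real.exp (-(b * T))) :=
  eventually_le_of_lt_liminf (lt_of_lt_of_le (by exact_mod_cast hb)
    ((rateBound_le_errorExponent hμ).trans (h μ hμ)))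

theorem isConsistent (h : alg.PerformsAsWellAsUniform) : alg.IsConsistent := by
  intro μ hμ
  have hB := rateBound_pos hμ
  refine tendsto_of_tendsto_of_tendsto_of_le_of_le' tendsto_const_nhds ?_
    (Eventually.of_forall fun _ => zero_le) (h.eventually_errorProb_le hμ (half_lt_self hB))
  rw [← ENNReal.ofReal_zero]
  refine ENNReal.tendsto_ofReal (Real.tendsto_exp_neg_atTop_nhds_zero.comp ?_)
  exact tendsto_natCast_atTop_atTop.const_mul_atTop (half_pos hB)

/-! ### Stability -/

/-- If `π` and `μ` have different best arms, the change of measure bounds the exponent on `μ` by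
the divergence of one round, averaged with the sampling proportions on `π`. -/
theorem eventually_le_divergence (h : alg.PerformsAsWellAsUniform) {π μ : Means}
    (hπ : π ∈ instances) (hμ : μ ∈ instances) {k j : Arm} (hkj : μ k < μ j) (hjk : π j < π k)
    {b : ℝ} (hb : b < rateBound (μ 0) (μ 1)) :
    ∀ᶠ T : ℕ in atTop, b ≤
      (1 - alg.expectedProportion π T 1) * bernoulliKL (π 0) (μ 0) +
        alg.expectedProportion π T 1 * bernoulliKL (π 1) (μ 1) := by
  obtain ⟨b', hbb', hb'⟩ := exists_between hb
  have hsum : ∀ T, alg.decisionProb π T k = 1 - (alg.errorProb π T).toReal := by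
    intro T
    rw [alg.errorProb_eq hjk, ENNReal.toReal_ofReal (alg.decisionProb_nonneg π T j),
      ← alg.decisionProb_add (ne_of_lt_means hkj) π T, add_sub_cancel_right]
  have hlim : Tendsto (fun T : ℕ => alg.decisionProb π T k * b' - Real.log 2 / T) atTop
      (𝓝 ((1 - 0) * b' - 0)) := by
    refine Tendsto.sub (Tendsto.mul_const b' ?_) (tendsto_const_div_atTop_nhds_zero_nat _)
    simp only [hsum]
    exact tendsto_const_nhds.sub
      ((ENNReal.tendsto_toReal ENNReal.zero_ne_top).comp (h.isConsistent π hπ))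
  filter_upwards [hlim.eventually (eventually_gt_nhds (show b < (1 - 0) * b' - 0 by simpa)),
    h.eventually_errorProb_le hμ hb', eventually_gt_atTop 0] with T h1 h2 hT
  rw [alg.errorProb_eq hkj, ENNReal.ofReal_le_ofReal_iff (Real.exp_pos _).le] at h2
  have h3 := alg.decisionProb_mul_le hπ hμ T k b' h2
  have hT' : (0 : ℝ) < T := by exact_mod_cast hT
  refine h1.le.trans (le_of_mul_le_mul_left ?_ hT')
  have : (T : ℝ) * (alg.decisionProb π T k * b' - Real.log 2 / T) =
      alg.decisionProb π T k * (b' * T) - Real.log 2 := by field_simp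
  linarith

/-- The instance `(a - w x, a + (1 - w) x)`, for small `x` of either sign, has an exponent
for uniform sampling of about `x² / (8 a (1 - a))`, whereas an algorithm that samples the
second arm with proportion `w` on `(a, a)` distinguishes the two instances at a rate of only about
`w (1 - w) x² / (2 a (1 - a))`, which is smaller if `w ≠ 1 / 2`. The constant `c` is a lower bound
for the variances near `a`, and `s` prescribes the sign of `x`. -/
lemma exists_alternative {a w s : ℝ} (ha : a ∈ Set.Ioo (0 : ℝ) 1) (hw : w ≠ 1 / 2)
    (hsgn : |s| = 1) :
    ∃ x c ρ : ℝ, 0 < s * x ∧ 0 < c ∧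
      a - w * x ∈ Set.Ioo (0 : ℝ) 1 ∧ a + (1 - w) * x ∈ Set.Ioo (0 : ℝ) 1 ∧
      w * (1 - w) * x ^ 2 / (2 * c) < rateBound (a - w * x) (a + (1 - w) * x) ∧
      0 < ρ ∧ a - w * x ∈ Metric.ball a ρ ∧ a + (1 - w) * x ∈ Metric.ball a ρ ∧
      ∀ y ∈ Metric.ball a ρ, c ≤ y * (1 - y) := by
  have hV : 0 < a * (1 - a) := mul_pos ha.1 (sub_pos.2 ha.2)
  have hw4 : 4 * (w * (1 - w)) < 1 := by
    have : 0 < (w - 1 / 2) ^ 2 := by have := sub_ne_zero.2 hw; positivity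
    linarith
  obtain ⟨c, hc1, hc2⟩ := exists_between
    (show max 0 (4 * (w * (1 - w)) * (a * (1 - a))) < a * (1 - a) from
      max_lt hV (by nlinarith))
  obtain ⟨hc0, hc1⟩ := max_lt_iff.1 hc1
  have hcont : ∀ᶠ y in 𝓝 a, c < y * (1 - y) :=
    (show ContinuousAt (fun y : ℝ => y * (1 - y)) a by fun_prop).eventually (eventually_gt_nhds hc2)
  obtain ⟨ρ, hρ, hball⟩ := Metric.eventually_nhds_iff_ball.1 hcont
  have hm0 : Tendsto (fun x : ℝ => a - w * x) (𝓝 0) (𝓝 a) :=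
    (show Continuous fun x : ℝ => a - w * x by fun_prop).tendsto' 0 a (by simp)
  have hm1 : Tendsto (fun x : ℝ => a + (1 - w) * x) (𝓝 0) (𝓝 a) :=
    (show Continuous fun x : ℝ => a + (1 - w) * x by fun_prop).tendsto' 0 a (by simp)
  have hrate : ∀ᶠ x in 𝓝 (0 : ℝ), 2 * (w * (1 - w)) * ((a - w * x) * (1 - (a + (1 - w) * x)) +
      (a + (1 - w) * x) * (1 - (a - w * x))) < c :=
    ((show Continuous fun x : ℝ => 2 * (w * (1 - w)) * ((a - w * x) * (1 - (a + (1 - w) * x)) +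
      (a + (1 - w) * x) * (1 - (a - w * x))) by fun_prop).tendsto 0).eventually
      (eventually_lt_nhds (by linarith))
  have hnear : ∀ᶠ y in 𝓝 a, y ∈ Set.Ioo (0 : ℝ) 1 ∧ y ∈ Metric.ball a ρ :=
    Filter.inter_mem (Ioo_mem_nhds ha.1 ha.2) (Metric.ball_mem_nhds a hρ)
  obtain ⟨τ, hτ, hτball⟩ := Metric.eventually_nhds_iff_ball.1
    (hrate.and ((hm0.eventually hnear).and (hm1.eventually hnear)))
  have hss : s * s = 1 := by rw [← abs_mul_abs_self, hsgn, one_mul]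
  have hx : s * (τ / 2) ∈ Metric.ball (0 : ℝ) τ := by
    rw [mem_ball_zero_iff, Real.norm_eq_abs, abs_mul, hsgn, one_mul, abs_of_pos (half_pos hτ)]
    exact half_lt_self hτ
  have hxpos : 0 < s * (s * (τ / 2)) := by rw [← mul_assoc, hss, one_mul]; exact half_pos hτ
  generalize s * (τ / 2) = x at hx hxpos
  obtain ⟨h1, ⟨h2, h3⟩, h4, h5⟩ := hτball x hx
  refine ⟨x, c, ρ, hxpos, hc0, h2, h4, ?_, hρ, h3, h5, fun y hy => (hball y hy).le⟩
  have hx2 : 0 < x ^ 2 := by have := right_ne_zero_of_mul hxpos.ne'; positivity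
  have hu := mul_pos h2.1 (sub_pos.2 h4.2)
  have hv := mul_pos h4.1 (sub_pos.2 h2.2)
  rw [rateBound, show (a - w * x - (a + (1 - w) * x)) ^ 2 = x ^ 2 by ring,
    div_lt_div_iff₀ (by positivity) (by positivity)]
  linear_combination 2 * x ^ 2 * h1

/-- Near `(a, a)`, on instances whose best arm is given by the sign `s` of the gap, the expected
sampling proportion of the second arm is eventually on the same side of `w` as `1 / 2`. -/
lemma eventually_proportion_side (h : alg.PerformsAsWellAsUniform) {a : I} (ha0 : (0 : ℝ) < a)
    (ha1 : (a : ℝ) < 1) {π : ℕ → Means} (hπ : ∀ n, π n ∈ instances)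
    (hlim : Tendsto π atTop (𝓝 fun _ => a)) {w s : ℝ} (hw : w ≠ 1 / 2) (hsgn : |s| = 1) :
    ∀ᶠ n in atTop, 0 < s * (π n 0 - π n 1) →
      ∀ᶠ T in atTop, 0 < (alg.expectedProportion (π n) T 1 - w) * (1 - 2 * w) := by
  obtain ⟨x, c, ρ, hx, hc, hm0, hm1, hrate, hρ, hb0', hb1', hball⟩ :=
    exists_alternative ⟨ha0, ha1⟩ hw hsgn
  set m₀ := (a : ℝ) - w * x
  set m₁ := (a : ℝ) + (1 - w) * x
  have hx' : m₁ - m₀ = x := by simp only [m₀, m₁]; ring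
  set μ : Means := ![⟨m₀, hm0.1.le, hm0.2.le⟩, ⟨m₁, hm1.1.le, hm1.2.le⟩]
  have hμ0 : (μ 0 : ℝ) = m₀ := rfl
  have hμ1 : (μ 1 : ℝ) = m₁ := rfl
  have hμ : μ ∈ instances := by
    refine ⟨fun k => ?_, fun he => ?_⟩
    · fin_cases k
      exacts [hm0, hm1]
    · have he : m₀ = m₁ := congrArg Subtype.val he
      rw [← hx', he, sub_self, mul_zero] at hx
      exact hx.false
  obtain ⟨b, hb, hbrate⟩ := exists_between hrate
  rw [div_lt_iff₀ (by positivity)] at hb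
  -- the margin left for replacing the limit `(a, a)` by `π n`
  set κ := b * (2 * c) - w * (1 - w) * x ^ 2
  have hκ : 0 < κ := sub_pos.2 hb
  have hcoord : ∀ k, Tendsto (fun n => (π n k : ℝ)) atTop (𝓝 (a : ℝ)) := fun k =>
    (continuous_subtype_val.tendsto a).comp ((tendsto_pi_nhds.1 hlim) k)
  have hsq : ∀ k m, Tendsto (fun n => ((π n k : ℝ) - m) ^ 2) atTop (𝓝 (((a : ℝ) - m) ^ 2)) :=
    fun k m => ((hcoord k).sub_const m).pow 2
  filter_upwards [(hcoord 0).eventually (Metric.ball_mem_nhds _ hρ),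
    (hcoord 1).eventually (Metric.ball_mem_nhds _ hρ),
    (hsq 0 m₀).eventually (eventually_lt_nhds (lt_add_of_pos_right _ hκ)),
    (hsq 1 m₁).eventually (eventually_lt_nhds (lt_add_of_pos_right _ hκ))]
    with n hn0 hn1 hs0 hs1 hsign
  have hKL : ∀ k, (π n k : ℝ) ∈ Metric.ball (a : ℝ) ρ → (μ k : ℝ) ∈ Metric.ball (a : ℝ) ρ →
      bernoulliKL (π n k) (μ k) ≤ ((π n k : ℝ) - μ k) ^ 2 / (2 * c) := fun k h1 h2 =>
    bernoulliKL_le ((hπ n).1 k) (hμ.1 k) hc fun y hy =>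
      hball y ((convex_ball (a : ℝ) ρ).ordConnected.uIcc_subset h1 h2 hy)
  have hrev : 0 < x * ((π n 0 : ℝ) - π n 1) := by
    have := mul_pos hx hsign
    rwa [show s * x * (s * ((π n 0 : ℝ) - π n 1)) = s * s * (x * ((π n 0 : ℝ) - π n 1)) by ring,
      ← abs_mul_abs_self, hsgn, one_mul, one_mul] at this
  have hdiv : ∀ᶠ T : ℕ in atTop, b ≤
      (1 - alg.expectedProportion (π n) T 1) * bernoulliKL (π n 0) (μ 0) +
        alg.expectedProportion (π n) T 1 * bernoulliKL (π n 1) (μ 1) := by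
    rcases lt_or_gt_of_ne (right_ne_zero_of_mul hx.ne') with hx0 | hx0
    · have hlt : (π n 0 : ℝ) < π n 1 := sub_neg.1 (neg_of_mul_pos_right hrev hx0.le)
      have hlt' : (μ 1 : ℝ) < μ 0 := by linarith
      exact h.eventually_le_divergence (hπ n) hμ hlt' hlt hbrate
    · have hlt : (π n 1 : ℝ) < π n 0 := sub_pos.1 (pos_of_mul_pos_right hrev hx0.le)
      have hlt' : (μ 0 : ℝ) < μ 1 := by linarith
      exact h.eventually_le_divergence (hπ n) hμ hlt' hlt hbrate
  filter_upwards [hdiv] with T hT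
  obtain ⟨hω0, hω1⟩ := alg.expectedProportion_mem (π n) T
  set ω := alg.expectedProportion (π n) T 1
  have hquad : b * (2 * c) ≤ (1 - ω) * ((π n 0 : ℝ) - m₀) ^ 2 + ω * ((π n 1 : ℝ) - m₁) ^ 2 := by
    rw [← le_div_iff₀ (by positivity), add_div, mul_div_assoc, mul_div_assoc]
    exact hT.trans (add_le_add
      (mul_le_mul_of_nonneg_left (hKL 0 hn0 hb0') (sub_nonneg.2 hω1))
      (mul_le_mul_of_nonneg_left (hKL 1 hn1 hb1') hω0))
  have hstrict : b * (2 * c) <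
      (1 - ω) * (((a : ℝ) - m₀) ^ 2 + κ) + ω * (((a : ℝ) - m₁) ^ 2 + κ) := by
    refine hquad.trans_lt ?_
    rcases hω0.eq_or_lt with h0 | h0
    · rw [← h0]; linarith
    · exact add_lt_add_of_le_of_lt (mul_le_mul_of_nonneg_left hs0.le (sub_nonneg.2 hω1))
        (mul_lt_mul_of_pos_left hs1 h0)
  have hfin : 0 < x ^ 2 * ((ω - w) * (1 - 2 * w)) := by
    simp only [κ, m₀, m₁] at hstrict
    linear_combination hstrict
  exact pos_of_mul_pos_right hfin (sq_nonneg x)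

theorem isStable (h : alg.PerformsAsWellAsUniform) : alg.IsStable := by
  intro a ha0 ha1 π hπ hlim ε hε
  have hlo : (1 / 2 : ℝ) - ε ≠ 1 / 2 := fun he => hε.ne' (by linarith)
  have hup : (1 / 2 : ℝ) + ε ≠ 1 / 2 := fun he => hε.ne' (by linarith)
  have side : ∀ s : ℝ, |s| = 1 → ∀ᶠ n in atTop, 0 < s * (π n 0 - π n 1) →
      ∀ᶠ T in atTop, |alg.expectedProportion (π n) T 1 - 1 / 2| < ε := by
    intro s hsgn
    filter_upwards [h.eventually_proportion_side ha0 ha1 hπ hlim hlo hsgn,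
      h.eventually_proportion_side ha0 ha1 hπ hlim hup hsgn] with n h1 h2 hn
    filter_upwards [h1 hn, h2 hn] with T h1 h2
    have h1 := pos_of_mul_pos_left h1 (by linarith)
    have h2 := neg_of_mul_pos_left h2 (by linarith)
    rw [abs_lt]
    constructor <;> linarith
  filter_upwards [side 1 (by simp), side (-1) (by simp)] with n h1 h2
  rcases lt_or_gt_of_ne (hπ n).2 with hn | hn
  · have hn : (π n 0 : ℝ) < π n 1 := hn
    exact h2 (by linarith)
  · have hn : (π n 1 : ℝ) < π n 0 := hn
    exact h1 (by linarith)

end Algorithm.PerformsAsWellAsUniform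

end TwoArmBandit

theorem mainTheorem2 (alg : TwoArmBandit.Algorithm)
    (h : alg.PerformsAsWellAsUniform) :
    alg.IsConsistent ∧ alg.IsStable :=
  ⟨h.isConsistent, h.isStable⟩
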